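/- Let $(\mathscr{B},\mathbb{E},\mathfrak{s})$ be a Krull--Schmidt extriangulated category (in the sense of Nakaoka--Palu) with enough projectives and enough injectives, satisfying condition (WIC): if $gf$ is an inflation then so is $f$, and if $gf$ is a deflation then so is $g$. Let $\mathbb{E}^i$ ($i\ge 1$) be the higher extension groups, $\mathbb{E}^{i+1}(X,Y)=\mathbb{E}(\Omega^iX,Y)$, where $\Omega$ denotes a syzygy. A subcategory means a full additive subcategory closed under isomorphisms and direct summands. For a class $\omega$ of objects (regarded as a full subcategory) of $\mathscr{B}$ put: - $\omega^{\bot}=\{Y\mid \mathbb{E}^i(X,Y)=0 \text{ for all } i\ge 1,\ X\in\omega\}$; $\omega$ is self-orthogonal if $\omega\subseteq\omega^{\bot}$; - $\hat\omega_0=\check\omega_0=\omega$; $A\in\hat\omega_{n+1}$ if there is an $\mathbb{E}$-triangle $K\to W\to A\dashrightarrow$ with $W\in\omega$, $K\in\hat\omega_n$; $A\in\check\omega_{n+1}$ if there is an $\mathbb{E}$-triangle $A\to W\to K\dashrightarrow$ with $W\in\omega$, $K\in\check\omega_n$; $\hat\omega=\bigcup_{n\ge 0}\hat\omega_n$ and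 $\check\omega=\bigcup_{n\ge 0}\check\omega_n$; - ${}_\omega\mathcal{X}$ is the class of objects $A$ for which there are $\mathbb{E}$-triangles $K_{n+1}\to W_n\to K_n\dashrightarrow$ ($n\ge 0$) with $K_0=A$, all $W_n\in\omega$ and all $K_n\in\omega^{\bot}$. Let $\mathcal{C}$ and $\mathcal{T}$ be self-orthogonal subcategories of $\mathscr{B}$ such that $\mathcal{T}\subseteq\hat{\mathcal{C}}$ and $\mathcal{C}\subseteq\check{\mathcal{T}}$ (that is, $\mathcal{T}$ is $\mathcal{C}$-tilting), and assume that $\mathcal{T}$ is finite, i.e. $\mathcal{T}=\mathrm{add}(T)$ for some object $T$, where $\mathrm{add}(T)$ consists of the objects isomorphic to direct summands of finite direct sums of copies of $T$. Then: 1. ${}_{\mathcal{C}}\mathcal{X}=({}_{\mathcal{T}}\mathcal{X})^{\vee}\cap\mathcal{C}^{\bot}$; 2. $({}_{\mathcal{T}}\mathcal{X})^{\vee}=({}_{\mathcal{C}}\mathcal{X})^{\vee}$, where $\omega^{\vee}=\check\omega$. -/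

import Mathlib

open CategoryTheory CategoryTheory.Limits

universe w v u

namespace Extri

attribute [local instance] hasBinaryBiproducts_of_finite_biproducts

/-- A sequence `A ⟶ M ⟶ C` with fixed end terms. -/
structure Seq {B : Type u} [Category.{v} B] (A C : B) where
  mid : B
  inc : A ⟶ mid
  proj : mid ⟶ C

/-- Two sequences with the same end terms are equivalent if an isomorphism of their middle terms
is compatible with both maps. -/
def Seq.Equiv {B : Type u} [Category.{v} B] {A C : B} (σ τ : Seq A C) : Prop :=
  ∃ b : σ.mid ≅ τ.mid, σ.inc ≫ b.hom = τ.inc ∧ b.hom ≫ τ.proj = σ.proj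

instance seqSetoid {B : Type u} [Category.{v} B] (A C : B) : Setoid (Seq A C) where
  r := Seq.Equiv
  iseqv :=
    { refl := fun σ => ⟨Iso.refl _, by simp, by simp⟩
      symm := by
        rintro σ τ ⟨b, h1, h2⟩
        exact ⟨b.symm, by simp [← h1], by simp [← h2]⟩
      trans := by
        rintro σ τ ρ ⟨b, h1, h2⟩ ⟨b', h3, h4⟩
        exact ⟨b ≪≫ b', by simp [← Category.assoc, h1, h3], by simp [h2, h4]⟩ }

/-- The data `(𝔼, 𝔰)` on an additive category: a bifunctor `𝔼 : Bᵒᵖ × B → Ab` (written in curried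
form, so that `𝔼(C, A) = (E.obj (op C)).obj A`) which is additive in both variables, and a map `𝔰`
assigning to each `δ ∈ 𝔼(C, A)` an equivalence class of sequences `A ⟶ M ⟶ C`. -/
structure ExtData (B : Type u) [Category.{v} B] [Preadditive B] where
  E : Bᵒᵖ ⥤ B ⥤ AddCommGrpCat.{w}
  additive_left : E.Additive
  additive_right : ∀ X : Bᵒᵖ, (E.obj X).Additive
  s : ∀ {C A : B}, (E.obj (Opposite.op C)).obj A → Quotient (seqSetoid A C)

namespace ExtData

variable {B : Type u} [Category.{v} B] [Preadditive B] [HasFiniteBiproducts B]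

/-- The group `𝔼(C, A)` of extensions. -/
abbrev Ext1 (S : ExtData.{w} B) (C A : B) : Type w := (S.E.obj (Opposite.op C)).obj A

/-- `a_* δ`. -/
def push (S : ExtData.{w} B) {C A A' : B} (a : A ⟶ A') (δ : S.Ext1 C A) : S.Ext1 C A' :=
  (S.E.obj (Opposite.op C)).map a δ

/-- `c^* δ`. -/
def pull (S : ExtData.{w} B) {C C' A : B} (c : C' ⟶ C) (δ : S.Ext1 C A) : S.Ext1 C' A :=
  (S.E.map c.op).app A δ

/-- The sequence `A ⟶ M ⟶ C` realizes `δ`, i.e. `A ⟶ M ⟶ C ⇢ δ` is an `𝔼`-triangle. -/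
def Realizes (S : ExtData.{w} B) {A M C : B} (x : A ⟶ M) (y : M ⟶ C) (δ : S.Ext1 C A) : Prop :=
  S.s δ = Quotient.mk (seqSetoid A C) ⟨M, x, y⟩

/-- The direct sum `δ ⊕ δ' ∈ 𝔼(C ⊞ C', A ⊞ A')`: the element with components `δ, 0, 0, δ'`. -/
noncomputable def extSum (S : ExtData.{w} B) {A C A' C' : B} (δ : S.Ext1 C A) (δ' : S.Ext1 C' A') :
    S.Ext1 (C ⊞ C') (A ⊞ A') :=
  S.push biprod.inl (S.pull biprod.fst δ) + S.push biprod.inr (S.pull biprod.snd δ')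

/-- The axioms of an extriangulated category `(B, 𝔼, 𝔰)` in the sense of Nakaoka and Palu.
(ET1) is contained in `ExtData`; the first three fields together are (ET2). -/
structure IsExtriangulated (S : ExtData.{w} B) : Prop where
  /-- `𝔰` is a realization: every morphism of extensions lifts to the middle terms. -/
  realization : ∀ {A M C A' M' C' : B} {x : A ⟶ M} {y : M ⟶ C} {x' : A' ⟶ M'} {y' : M' ⟶ C'}
    {δ : S.Ext1 C A} {δ' : S.Ext1 C' A'}, S.Realizes x y δ → S.Realizes x' y' δ' →
    ∀ (a : A ⟶ A') (c : C ⟶ C'), S.push a δ = S.pull c δ' →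
      ∃ b : M ⟶ M', x ≫ b = a ≫ x' ∧ y ≫ c = b ≫ y'
  /-- `𝔰(0) = 0`. -/
  realizes_zero : ∀ A C : B,
    S.Realizes (biprod.inl : A ⟶ A ⊞ C) (biprod.snd : A ⊞ C ⟶ C) (0 : S.Ext1 C A)
  /-- `𝔰(δ ⊕ δ') = 𝔰(δ) ⊕ 𝔰(δ')`. -/
  realizes_sum : ∀ {A M C A' M' C' : B} {x : A ⟶ M} {y : M ⟶ C} {x' : A' ⟶ M'} {y' : M' ⟶ C'}
    {δ : S.Ext1 C A} {δ' : S.Ext1 C' A'}, S.Realizes x y δ → S.Realizes x' y' δ' →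
    S.Realizes (biprod.map x x') (biprod.map y y') (S.extSum δ δ')
  /-- (ET3) -/
  et3 : ∀ {A M C A' M' C' : B} {x : A ⟶ M} {y : M ⟶ C} {x' : A' ⟶ M'} {y' : M' ⟶ C'}
    {δ : S.Ext1 C A} {δ' : S.Ext1 C' A'}, S.Realizes x y δ → S.Realizes x' y' δ' →
    ∀ (a : A ⟶ A') (b : M ⟶ M'), x ≫ b = a ≫ x' →
      ∃ c : C ⟶ C', y ≫ c = b ≫ y' ∧ S.push a δ = S.pull c δ'
  /-- The dual of (ET3). -/
  et3_op : ∀ {A M C A' M' C' : B} {x : A ⟶ M} {y : M ⟶ C} {x' : A' ⟶ M'} {y' : M' ⟶ C'}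
    {δ : S.Ext1 C A} {δ' : S.Ext1 C' A'}, S.Realizes x y δ → S.Realizes x' y' δ' →
    ∀ (b : M ⟶ M') (c : C ⟶ C'), y ≫ c = b ≫ y' →
      ∃ a : A ⟶ A', x ≫ b = a ≫ x' ∧ S.push a δ = S.pull c δ'
  /-- (ET4) -/
  et4 : ∀ {A M D C F : B} {f : A ⟶ M} {f' : M ⟶ D} {g : M ⟶ C} {g' : C ⟶ F}
    {δ : S.Ext1 D A} {δ' : S.Ext1 F M}, S.Realizes f f' δ → S.Realizes g g' δ' →
    ∃ (N : B) (h' : C ⟶ N) (d : D ⟶ N) (e : N ⟶ F) (δ'' : S.Ext1 N A),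
      f' ≫ d = g ≫ h' ∧ h' ≫ e = g' ∧
      S.Realizes (f ≫ g) h' δ'' ∧
      S.Realizes d e (S.push f' δ') ∧
      S.pull d δ'' = δ ∧
      S.push f δ'' = S.pull e δ'
  /-- The dual of (ET4). -/
  et4_op : ∀ {A M D C F : B} {f' : D ⟶ M} {f : M ⟶ A} {g' : F ⟶ C} {g : C ⟶ M}
    {δ : S.Ext1 A D} {δ' : S.Ext1 M F}, S.Realizes f' f δ → S.Realizes g' g δ' →
    ∃ (N : B) (h' : N ⟶ C) (d : N ⟶ D) (e : F ⟶ N) (δ'' : S.Ext1 A N),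
      d ≫ f' = h' ≫ g ∧ e ≫ h' = g' ∧
      S.Realizes h' (g ≫ f) δ'' ∧
      S.Realizes e d (S.pull f' δ') ∧
      S.push d δ'' = δ ∧
      S.pull f δ'' = S.push e δ'

/-- `A ⟶ M ⟶ C` is a conflation. -/
def IsConflation (S : ExtData.{w} B) {A M C : B} (x : A ⟶ M) (y : M ⟶ C) : Prop :=
  ∃ δ : S.Ext1 C A, S.Realizes x y δ

def IsInflation (S : ExtData.{w} B) {A M : B} (x : A ⟶ M) : Prop :=
  ∃ (C : B) (y : M ⟶ C), S.IsConflation x y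

def IsDeflation (S : ExtData.{w} B) {M C : B} (y : M ⟶ C) : Prop :=
  ∃ (A : B) (x : A ⟶ M), S.IsConflation x y

/-- There is an `𝔼`-triangle `A ⟶ M ⟶ C ⇢`. -/
def Triangle (S : ExtData.{w} B) (A M C : B) : Prop :=
  ∃ (x : A ⟶ M) (y : M ⟶ C), S.IsConflation x y

/-- The weak idempotent completeness condition (WIC) for inflations and deflations. -/
structure WIC (S : ExtData.{w} B) : Prop where
  inflation : ∀ {X Y Z : B} (f : X ⟶ Y) (g : Y ⟶ Z), S.IsInflation (f ≫ g) → S.IsInflation f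
  deflation : ∀ {X Y Z : B} (f : X ⟶ Y) (g : Y ⟶ Z), S.IsDeflation (f ≫ g) → S.IsDeflation g

def IsProjective (S : ExtData.{w} B) (P : B) : Prop :=
  ∀ {A M C : B} (x : A ⟶ M) (y : M ⟶ C), S.IsConflation x y →
    ∀ c : P ⟶ C, ∃ b : P ⟶ M, b ≫ y = c

def IsInjective (S : ExtData.{w} B) (I : B) : Prop :=
  ∀ {A M C : B} (x : A ⟶ M) (y : M ⟶ C), S.IsConflation x y →
    ∀ a : A ⟶ I, ∃ b : M ⟶ I, x ≫ b = a

class EnoughProjectives (S : ExtData.{w} B) : Prop where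
  exists_triangle : ∀ C : B, ∃ A P : B, S.IsProjective P ∧ S.Triangle A P C

class EnoughInjectives (S : ExtData.{w} B) : Prop where
  exists_triangle : ∀ A : B, ∃ I C : B, S.IsInjective I ∧ S.Triangle A I C

/-- A chosen syzygy `Ω X`: there is an `𝔼`-triangle `Ω X ⟶ P ⟶ X ⇢` with `P` projective. -/
noncomputable def syzygy (S : ExtData.{w} B) [S.EnoughProjectives] (X : B) : B :=
  (EnoughProjectives.exists_triangle (S := S) X).choose

/-- The iterated syzygy `Ωⁿ X`. -/
noncomputable def iterSyzygy (S : ExtData.{w} B) [S.EnoughProjectives] (n : ℕ) (X : B) : B :=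
  S.syzygy^[n] X

/-- The higher extension group `𝔼ⁿ⁺¹(X, Y) = 𝔼(Ωⁿ X, Y)`; the parameter `n` stands for
degree `n + 1`, so that `n : ℕ` ranges over all degrees `≥ 1`. -/
abbrev ExtSucc (S : ExtData.{w} B) [S.EnoughProjectives] (n : ℕ) (X Y : B) : Type w :=
  S.Ext1 (S.iterSyzygy n X) Y

/-- `ω^⊥`: the objects `Y` with `𝔼ⁱ(X, Y) = 0` for all `i ≥ 1` and all `X ∈ ω`. -/
def rightPerp (S : ExtData.{w} B) [S.EnoughProjectives] (ω : ObjectProperty B) :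
    ObjectProperty B :=
  fun Y => ∀ X, ω X → ∀ (n : ℕ) (δ : S.ExtSucc n X Y), δ = 0

/-- `ω` is self-orthogonal: `𝔼ⁱ(X, Y) = 0` for all `i ≥ 1` and all `X, Y ∈ ω`. -/
def SelfOrthogonal (S : ExtData.{w} B) [S.EnoughProjectives] (ω : ObjectProperty B) : Prop :=
  ω ≤ S.rightPerp ω

/-- The objects `A` with an `𝔼`-triangle sequence `Wₙ ⟶ ⋯ ⟶ W₁ ⟶ W₀ ⟶ A`, all `Wᵢ ∈ ω`. -/
def hatN (S : ExtData.{w} B) (ω : ObjectProperty B) : ℕ → ObjectProperty B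
  | 0 => ω
  | n + 1 => fun A => ∃ K W : B, ω W ∧ S.hatN ω n K ∧ S.Triangle K W A

/-- The objects `A` with an `𝔼`-triangle sequence `A ⟶ W⁰ ⟶ W¹ ⟶ ⋯ ⟶ Wⁿ`, all `Wⁱ ∈ ω`. -/
def checkN (S : ExtData.{w} B) (ω : ObjectProperty B) : ℕ → ObjectProperty B
  | 0 => ω
  | n + 1 => fun A => ∃ W K : B, ω W ∧ S.checkN ω n K ∧ S.Triangle A W K

/-- The union of the `hatN` over all `n`. -/
def hat (S : ExtData.{w} B) (ω : ObjectProperty B) : ObjectProperty B :=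
  fun A => ∃ n, S.hatN ω n A

/-- The union of the `checkN` over all `n`. -/
def check (S : ExtData.{w} B) (ω : ObjectProperty B) : ObjectProperty B :=
  fun A => ∃ n, S.checkN ω n A

/-- `_ω𝒳`: the objects `A` with an infinite `𝔼`-triangle sequence `⋯ ⟶ W₁ ⟶ W₀ ⟶ A`, composed of
`𝔼`-triangles `Kₙ₊₁ ⟶ Wₙ ⟶ Kₙ ⇢` with `K₀ = A`, all `Wₙ ∈ ω` and all `Kₙ ∈ ω^⊥`. -/
def leftX (S : ExtData.{w} B) [S.EnoughProjectives] (ω : ObjectProperty B) : ObjectProperty B :=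
  fun A => ∃ K W : ℕ → B, K 0 = A ∧
    ∀ n, ω (W n) ∧ S.rightPerp ω (K n) ∧ S.Triangle (K (n + 1)) (W n) (K n)

/-- `(𝒞, 𝒯)` is a tilting pair, i.e. `𝒯` is `𝒞`-tilting. -/
structure IsTiltingPair (S : ExtData.{w} B) [S.EnoughProjectives]
    (𝒞 𝒯 : ObjectProperty B) : Prop where
  left_selfOrthogonal : S.SelfOrthogonal 𝒞
  right_selfOrthogonal : S.SelfOrthogonal 𝒯
  right_le : 𝒯 ≤ S.hat 𝒞
  left_le : 𝒞 ≤ S.check 𝒯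

end ExtData

/-- A Krull–Schmidt category: each object is a finite direct sum of objects with local
endomorphism rings. -/
def IsKrullSchmidt (B : Type u) [Category.{v} B] [Preadditive B] [HasFiniteBiproducts B] : Prop :=
  ∀ X : B, ∃ (n : ℕ) (f : Fin n → B), (∀ i, IsLocalRing (End (f i))) ∧ Nonempty (X ≅ ⨁ f)

/-- A full additive subcategory closed under isomorphisms and direct summands. -/
structure IsSubcategory {B : Type u} [Category.{v} B] [Preadditive B] [HasFiniteBiproducts B]
    (ω : ObjectProperty B) : Prop where
  iso : ∀ {X Y : B}, (X ≅ Y) → ω X → ω Y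
  zero : ∀ {Z : B}, IsZero Z → ω Z
  sum : ∀ {X Y : B}, ω X → ω Y → ω (X ⊞ Y)
  summand : ∀ {X Y : B}, ω (X ⊞ Y) → ω X

/-- `add T`: the objects isomorphic to direct summands of finite direct sums of copies of `T`. -/
def addClosure {B : Type u} [Category.{v} B] [Preadditive B] [HasFiniteBiproducts B] (T : B) :
    ObjectProperty B :=
  fun X => ∃ (n : ℕ) (Y : B), Nonempty (X ⊞ Y ≅ ⨁ fun _ : Fin n => T)

/-- `ω` is finite: `ω = add T` for some object `T`. -/
def IsFinite {B : Type u} [Category.{v} B] [Preadditive B] [HasFiniteBiproducts B]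
    (ω : ObjectProperty B) : Prop :=
  ∃ T : B, ω = addClosure T

end Extri

set_option linter.unusedSectionVars false
set_option linter.unusedVariables false

/-! Infinite resolutions are built coinductively: by `le_leftX` it suffices to exhibit a class
inside `ω^⊥` in which each object is the cone of an inflation from the class into `ω`.

The second assertion carries the first: `_𝒞𝒳` absorbs kernels in `𝒞^⊥` of deflations between its
objects (`leftX_of_rightPerp`), so an object of `𝒞^⊥` with a finite `_𝒞𝒳`-coresolution lies in
`_𝒞𝒳`.

In the second assertion one inclusion comes from `leftX_le`, which splices `𝒞`-resolutions of the
terms of a `𝒯`-resolution. For the other, each `Y` in `_𝒞𝒳` is placed in a triangle `Y ⟶ U ⟶ L` with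
`U` in `_𝒯𝒳` and `L` in `check 𝒯` (`exists_triangle_check`). As `𝒯 = add T` and `T` has a finite
`𝒞`-resolution, one degree bounds all nonzero extensions from `𝒯` to `𝒞^⊥` (`exists_orthN`). Passing
to syzygies and pushing out lowers that bound to zero (`exists_triangle_orthN`), and `_𝒞𝒳 ∩ 𝒯^⊥`
lies in `_𝒯𝒳` (`leftX_inf_rightPerp_le`). Finally `check_mid` extends this from `_𝒞𝒳` to its finite
coresolutions. -/

namespace Extri

attribute [local instance] hasBinaryBiproducts_of_finite_biproducts

namespace ExtData

variable {B : Type u} [Category.{v} B] [Preadditive B] [HasFiniteBiproducts B]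

/-! ### Bifunctoriality of `𝔼` -/

section Functoriality

variable (S : ExtData.{w} B)

lemma push_add {C A A' : B} (a : A ⟶ A') (δ ε : S.Ext1 C A) :
    S.push a (δ + ε) = S.push a δ + S.push a ε :=
  map_add ((S.E.obj (Opposite.op C)).map a).hom δ ε

lemma pull_add {C C' A : B} (c : C' ⟶ C) (δ ε : S.Ext1 C A) :
    S.pull c (δ + ε) = S.pull c δ + S.pull c ε :=
  map_add ((S.E.map c.op).app A).hom δ ε

@[simp]
lemma push_zero {C A A' : B} (a : A ⟶ A') : S.push a (0 : S.Ext1 C A) = 0 :=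
  map_zero ((S.E.obj (Opposite.op C)).map a).hom

@[simp]
lemma pull_zero {C C' A : B} (c : C' ⟶ C) : S.pull c (0 : S.Ext1 C A) = 0 :=
  map_zero ((S.E.map c.op).app A).hom

@[simp]
lemma push_id {C A : B} (δ : S.Ext1 C A) : S.push (𝟙 A) δ = δ := by
  simp [push]

@[simp]
lemma pull_id {C A : B} (δ : S.Ext1 C A) : S.pull (𝟙 C) δ = δ := by
  simp [pull]

lemma push_comp {C A A' A'' : B} (a : A ⟶ A') (a' : A' ⟶ A'') (δ : S.Ext1 C A) :
    S.push (a ≫ a') δ = S.push a' (S.push a δ) := by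
  simp [push]

lemma pull_comp {C C' C'' A : B} (c : C' ⟶ C) (c' : C'' ⟶ C') (δ : S.Ext1 C A) :
    S.pull (c' ≫ c) δ = S.pull c' (S.pull c δ) := by
  simp [pull]

@[simp]
lemma zero_push {C A A' : B} (δ : S.Ext1 C A) : S.push (0 : A ⟶ A') δ = 0 := by
  have := S.additive_right (Opposite.op C)
  simp [push]

@[simp]
lemma zero_pull {C C' A : B} (δ : S.Ext1 C A) : S.pull (0 : C' ⟶ C) δ = 0 := by
  have := S.additive_left
  simp [pull]

lemma push_pull {C C' A A' : B} (a : A ⟶ A') (c : C' ⟶ C) (δ : S.Ext1 C A) :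
    S.push a (S.pull c δ) = S.pull c (S.push a δ) :=
  (NatTrans.naturality_apply (S.E.map c.op) a δ).symm

lemma pull_sum {ι : Type*} (s : Finset ι) {C C' A : B} (c : ι → (C' ⟶ C)) (δ : S.Ext1 C A) :
    S.pull (∑ i ∈ s, c i) δ = ∑ i ∈ s, S.pull (c i) δ := by
  classical
  have := S.additive_left
  induction s using Finset.induction_on with
  | empty => simp
  | insert a s ha ih =>
    rw [Finset.sum_insert ha, Finset.sum_insert ha, ← ih]
    simp [pull]

end Functoriality

/-! ### Lifting and extension along `𝔼`-triangles -/

section Realization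

variable {S : ExtData.{w} B}

lemma exists_realizes {C A : B} (δ : S.Ext1 C A) :
    ∃ (M : B) (x : A ⟶ M) (y : M ⟶ C), S.Realizes x y δ := by
  obtain ⟨σ, hσ⟩ := Quotient.exists_rep (S.s δ)
  exact ⟨σ.mid, σ.inc, σ.proj, hσ.symm⟩

lemma Realizes.iso {A M M' C : B} {x : A ⟶ M} {y : M ⟶ C} {x' : A ⟶ M'} {y' : M' ⟶ C}
    {δ : S.Ext1 C A} (h : S.Realizes x y δ) (h' : S.Realizes x' y' δ) : Nonempty (M ≅ M') := by
  obtain ⟨b, -, -⟩ := Quotient.exact (h.symm.trans h')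
  exact ⟨b⟩

lemma Triangle.of_iso {A M M' C : B} (h : S.Triangle A M C) (e : M ≅ M') :
    S.Triangle A M' C := by
  obtain ⟨x, y, δ, h⟩ := h
  refine ⟨x ≫ e.hom, e.inv ≫ y, δ, h.trans (Quotient.sound ⟨e, rfl, ?_⟩)⟩
  simp

lemma Realizes.triangle {A M C : B} {x : A ⟶ M} {y : M ⟶ C} {δ : S.Ext1 C A}
    (h : S.Realizes x y δ) : S.Triangle A M C :=
  ⟨x, y, δ, h⟩

namespace IsExtriangulated

variable (hS : S.IsExtriangulated)
include hS

/-- A morphism into the last term along which the extension pulls back to zero lifts. -/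
lemma exists_lift {A M C X : B} {x : A ⟶ M} {y : M ⟶ C} {δ : S.Ext1 C A}
    (h : S.Realizes x y δ) (c : X ⟶ C) (hc : S.pull c δ = 0) : ∃ b : X ⟶ M, b ≫ y = c := by
  obtain ⟨b, -, hb⟩ := hS.realization (hS.realizes_zero A X) h (𝟙 A) c (by simp [hc])
  exact ⟨biprod.inr ≫ b, by rw [Category.assoc, ← hb]; simp⟩

/-- A morphism from the first term along which the extension pushes out to zero extends. -/
lemma exists_extension {A M C X : B} {x : A ⟶ M} {y : M ⟶ C} {δ : S.Ext1 C A}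
    (h : S.Realizes x y δ) (a : A ⟶ X) (ha : S.push a δ = 0) : ∃ b : M ⟶ X, x ≫ b = a := by
  obtain ⟨b, hb, -⟩ := hS.realization h (hS.realizes_zero X C) a (𝟙 C) (by simp [ha])
  exact ⟨b ≫ biprod.fst, by rw [← Category.assoc, hb]; simp⟩

lemma push_inc_eq_zero {A M C : B} {x : A ⟶ M} {y : M ⟶ C} {δ : S.Ext1 C A}
    (h : S.Realizes x y δ) : S.push x δ = 0 := by
  obtain ⟨c, -, hc⟩ := hS.et3 h (hS.realizes_zero M C) x biprod.inl rfl
  rw [hc, pull_zero]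

lemma pull_proj_eq_zero {A M C : B} {x : A ⟶ M} {y : M ⟶ C} {δ : S.Ext1 C A}
    (h : S.Realizes x y δ) : S.pull y δ = 0 := by
  obtain ⟨a, -, ha⟩ := hS.et3_op (hS.realizes_zero A M) h biprod.snd y rfl
  rw [← ha, push_zero]

end IsExtriangulated

end Realization

/-- `𝔼(X, Y) = 0`. -/
def Orth (S : ExtData.{w} B) (X Y : B) : Prop := ∀ δ : S.Ext1 X Y, δ = 0

variable {S : ExtData.{w} B}

lemma Orth.of_retract_left {X X' Y : B} (h : S.Orth X Y) (i : X' ⟶ X) (r : X ⟶ X')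
    (hir : i ≫ r = 𝟙 X') : S.Orth X' Y := fun δ => by
  rw [← S.pull_id δ, ← hir, pull_comp, h (S.pull r δ), pull_zero]

lemma Orth.of_retract_right {X Y Y' : B} (h : S.Orth X Y) (i : Y' ⟶ Y) (r : Y ⟶ Y')
    (hir : i ≫ r = 𝟙 Y') : S.Orth X Y' := fun δ => by
  rw [← S.push_id δ, ← hir, push_comp, h (S.push i δ), push_zero]

lemma Orth.of_addClosure {T X Y : B} (h : S.Orth T Y) (hX : addClosure T X) : S.Orth X Y := by
  obtain ⟨n, Z, ⟨e⟩⟩ := hX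
  have hsum : S.Orth (⨁ fun _ : Fin n => T) Y := fun δ => by
    rw [← S.pull_id δ, ← biproduct.total, pull_sum]
    refine Finset.sum_eq_zero fun i _ => ?_
    rw [pull_comp, h (S.pull _ δ), pull_zero]
  exact hsum.of_retract_left (biprod.inl ≫ e.hom) (e.inv ≫ biprod.fst) (by simp)

/-! ### Splitting and object-level diagrams -/

namespace IsExtriangulated

variable (hS : S.IsExtriangulated)
include hS

lemma triangle_split (A C : B) : S.Triangle A (A ⊞ C) C :=
  (hS.realizes_zero A C).triangle

lemma triangle_zero_left {Z : B} (hZ : IsZero Z) (A : B) : S.Triangle Z A A :=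
  (hS.triangle_split Z A).of_iso
    { hom := biprod.snd
      inv := biprod.inr
      hom_inv_id := by ext <;> first | exact hZ.eq_of_src _ _ | simp
      inv_hom_id := by simp }

lemma triangle_zero_right {Z : B} (hZ : IsZero Z) (A : B) : S.Triangle A A Z :=
  (hS.triangle_split A Z).of_iso
    { hom := biprod.fst
      inv := biprod.inl
      hom_inv_id := by ext <;> first | exact hZ.eq_of_tgt _ _ | exact hZ.eq_of_src _ _ | simp
      inv_hom_id := by simp }

lemma orth_injective {I : B} (hI : S.IsInjective I) (X : B) : S.Orth X I := fun δ => by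
  obtain ⟨M, x, y, h⟩ := exists_realizes δ
  obtain ⟨r, hr⟩ := hI x y ⟨δ, h⟩ (𝟙 I)
  rw [← S.push_id δ, ← hr, push_comp, hS.push_inc_eq_zero h, push_zero]

lemma orth_projective {P : B} (hP : S.IsProjective P) (Y : B) : S.Orth P Y := fun δ => by
  obtain ⟨M, x, y, h⟩ := exists_realizes δ
  obtain ⟨r, hr⟩ := hP x y ⟨δ, h⟩ (𝟙 P)
  rw [← S.pull_id δ, ← hr, pull_comp, hS.pull_proj_eq_zero h, pull_zero]

lemma iso_biprod_of_orth {A M C : B} (h : S.Triangle A M C) (hCA : S.Orth C A) :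
    Nonempty (M ≅ A ⊞ C) := by
  obtain ⟨x, y, δ, h⟩ := h
  obtain rfl := hCA δ
  exact h.iso (hS.realizes_zero A C)

lemma exists_fac_inc {A M C X : B} {x : A ⟶ M} {y : M ⟶ C} {δ : S.Ext1 C A}
    (h : S.Realizes x y δ) (b : X ⟶ M) (hb : b ≫ y = 0) : ∃ a : X ⟶ A, a ≫ x = b := by
  obtain ⟨a, ha, -⟩ := hS.et3_op (hS.realizes_zero X X) h (biprod.fst ≫ b) 0 (by simp [hb])
  exact ⟨a, by simpa using ha.symm⟩

lemma exists_fac_proj {A M C X : B} {x : A ⟶ M} {y : M ⟶ C} {δ : S.Ext1 C A}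
    (h : S.Realizes x y δ) (b : M ⟶ X) (hb : x ≫ b = 0) : ∃ c : C ⟶ X, y ≫ c = b := by
  obtain ⟨c, hc, -⟩ := hS.et3 h (hS.realizes_zero X X) 0 (b ≫ biprod.inr) (by
    rw [reassoc_of% hb]; simp)
  exact ⟨c, by simpa using hc⟩

/-- (ET4) on the level of objects. -/
lemma exists_triangles_of_inflations {A M D C F : B} (h : S.Triangle A M D)
    (h' : S.Triangle M C F) : ∃ N, S.Triangle A C N ∧ S.Triangle D N F := by
  obtain ⟨f, f', δ, h⟩ := h
  obtain ⟨g, g', δ', h'⟩ := h'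
  obtain ⟨N, _, _, _, _, _, _, h1, h2, _⟩ := hS.et4 h h'
  exact ⟨N, h1.triangle, h2.triangle⟩

/-- The dual of (ET4) on the level of objects. -/
lemma exists_triangles_of_deflations {A M D C F : B} (h : S.Triangle D M A)
    (h' : S.Triangle F C M) : ∃ N, S.Triangle N C A ∧ S.Triangle F N D := by
  obtain ⟨f, f', δ, h⟩ := h
  obtain ⟨g, g', δ', h'⟩ := h'
  obtain ⟨N, _, _, _, _, _, _, h1, h2, _⟩ := hS.et4_op h h'
  exact ⟨N, h1.triangle, h2.triangle⟩

/-- A morphism of `𝔼`-triangles which is invertible on the end terms is invertible. -/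
lemma isIso_of_isIso {A M C A' M' C' : B} {x : A ⟶ M} {y : M ⟶ C} {x' : A' ⟶ M'} {y' : M' ⟶ C'}
    {δ : S.Ext1 C A} {δ' : S.Ext1 C' A'} (h : S.Realizes x y δ) (h' : S.Realizes x' y' δ')
    (a : A ≅ A') (b : M ⟶ M') (c : C ≅ C') (hx : x ≫ b = a.hom ≫ x') (hy : y ≫ c.hom = b ≫ y')
    (hδ : S.push a.hom δ = S.pull c.hom δ') : IsIso b := by
  have hδ₁ : S.pull c.inv δ = S.push a.inv δ' := by
    calc S.pull c.inv δ = S.pull c.inv (S.push a.inv (S.push a.hom δ)) := by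
          rw [← push_comp, a.hom_inv_id, push_id]
      _ = S.push a.inv δ' := by
          rw [hδ, push_pull, ← pull_comp, c.inv_hom_id, pull_id]
  -- `t` and `r` are one-sided inverses of `b` up to errors factoring through `x'` and `y`;
  -- subtracting these gives a right and a left inverse.
  obtain ⟨t, ht⟩ := hS.exists_lift h (y' ≫ c.inv) (by
    rw [pull_comp, hδ₁, ← push_pull, hS.pull_proj_eq_zero h', push_zero])
  obtain ⟨s, hs⟩ := hS.exists_fac_inc h' (t ≫ b - 𝟙 M') (by
    rw [Preadditive.sub_comp, Category.assoc, ← hy, reassoc_of% ht]; simp)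
  obtain ⟨r, hr⟩ := hS.exists_extension h' (a.inv ≫ x) (by
    rw [push_comp, ← hδ₁, push_pull, hS.push_inc_eq_zero h, pull_zero])
  obtain ⟨q, hq⟩ := hS.exists_fac_proj h (b ≫ r - 𝟙 M) (by
    rw [Preadditive.comp_sub, reassoc_of% hx, hr]; simp)
  have hleft : (t - s ≫ a.inv ≫ x) ≫ b = 𝟙 M' := by
    rw [Preadditive.sub_comp]
    simp only [Category.assoc, hx, Iso.inv_hom_id_assoc, hs]
    abel
  have hright : b ≫ (r - y' ≫ c.inv ≫ q) = 𝟙 M := by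
    rw [Preadditive.comp_sub, ← reassoc_of% hy, c.hom_inv_id_assoc, hq]
    abel
  have : IsSplitEpi b := ⟨⟨⟨_, hleft⟩⟩⟩
  have : Mono b := (IsSplitMono.mk' ⟨_, hright⟩).mono
  exact isIso_of_mono_of_isSplitEpi b

lemma triangle_of_iso_ends {A A' M C C' : B} (h : S.Triangle A M C) (a : A ≅ A') (c : C ≅ C') :
    S.Triangle A' M C' := by
  obtain ⟨x, y, δ, h⟩ := h
  obtain ⟨M', x', y', h'⟩ := exists_realizes (S.push a.hom (S.pull c.inv δ))
  have hδ : S.push a.hom δ = S.pull c.hom (S.push a.hom (S.pull c.inv δ)) := by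
    rw [← push_pull, ← pull_comp, c.hom_inv_id, pull_id]
  obtain ⟨b, hx, hy⟩ := hS.realization h h' a.hom c.hom hδ
  have := hS.isIso_of_isIso h h' a b c hx hy hδ
  exact h'.triangle.of_iso (asIso b).symm

lemma realizes_inr (A C : B) :
    S.Realizes (biprod.inr : A ⟶ C ⊞ A) biprod.fst (0 : S.Ext1 C A) :=
  (hS.realizes_zero A C).trans (Quotient.sound ⟨biprod.braiding A C, by ext <;> simp, by simp⟩)

/-- The pushout of two inflations. -/
lemma exists_pushout {K M Y U L : B} (h : S.Triangle K M Y) (h' : S.Triangle K U L) :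
    ∃ V, S.Triangle U V Y ∧ S.Triangle M V L := by
  obtain ⟨x, y, δ, h⟩ := h
  obtain ⟨x', y', θ, h'⟩ := h'
  -- The pushout realizes the extension of `Y ⊞ L` by `K` with components `δ` and `θ`. The kernel of
  -- `V ⟶ Y` realizes its restriction to `L`, which is `θ`; symmetrically for `V ⟶ L`.
  obtain ⟨V, g', g, hV⟩ := exists_realizes
    (S.pull (biprod.fst : Y ⊞ L ⟶ Y) δ + S.pull (biprod.snd : Y ⊞ L ⟶ L) θ)
  refine ⟨V, ?_, ?_⟩
  · obtain ⟨N, _, _, _, _, _, _, h1, h2, _⟩ := hS.et4_op (hS.realizes_inr L Y) hV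
    rw [pull_add, ← pull_comp, ← pull_comp] at h2
    simp only [biprod.inr_fst, biprod.inr_snd, zero_pull, pull_id, zero_add] at h2
    obtain ⟨e⟩ := h2.iso h'
    exact hS.triangle_of_iso_ends h1.triangle e (Iso.refl _)
  · obtain ⟨N, _, _, _, _, _, _, h1, h2, _⟩ := hS.et4_op (hS.realizes_zero Y L) hV
    rw [pull_add, ← pull_comp, ← pull_comp] at h2
    simp only [biprod.inl_fst, biprod.inl_snd, zero_pull, pull_id, add_zero] at h2
    obtain ⟨e⟩ := h2.iso h
    exact hS.triangle_of_iso_ends h1.triangle e (Iso.refl _)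

/-- The pullback of two deflations. -/
lemma exists_pullback {K M Y U L : B} (h : S.Triangle K M Y) (h' : S.Triangle L U Y) :
    ∃ V, S.Triangle K V U ∧ S.Triangle L V M := by
  obtain ⟨x, y, δ, h⟩ := h
  obtain ⟨x', y', θ, h'⟩ := h'
  obtain ⟨V, g, g', hV⟩ := exists_realizes
    (S.push (biprod.inl : K ⟶ K ⊞ L) δ + S.push (biprod.inr : L ⟶ K ⊞ L) θ)
  refine ⟨V, ?_, ?_⟩
  · obtain ⟨N, _, _, _, _, _, _, h1, h2, _⟩ := hS.et4 (hS.realizes_zero K L) hV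
    rw [push_add, ← push_comp, ← push_comp] at h2
    simp only [biprod.inl_snd, biprod.inr_snd, zero_push, push_id, zero_add] at h2
    obtain ⟨e⟩ := h2.iso h'
    exact hS.triangle_of_iso_ends h1.triangle (Iso.refl _) e
  · obtain ⟨N, _, _, _, _, _, _, h1, h2, _⟩ := hS.et4 (hS.realizes_inr L K) hV
    rw [push_add, ← push_comp, ← push_comp] at h2
    simp only [biprod.inl_fst, biprod.inr_fst, zero_push, push_id, add_zero] at h2
    obtain ⟨e⟩ := h2.iso h
    exact hS.triangle_of_iso_ends h1.triangle (Iso.refl _) e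

/-- If `V` is the split extension of `L` by `Z`, an inflation `L ⟶ T` with cone `L'` gives an
inflation from `V` to an extension of `T` by `Z`, with the same cone. -/
lemma exists_inflation_of_split {Z V L T L' : B} (h : S.Triangle Z V L) (hLZ : S.Orth L Z)
    (h' : S.Triangle L T L') : ∃ Q, S.Triangle V Q L' ∧ S.Triangle Z Q T := by
  obtain ⟨x, y, κ, h⟩ := h
  obtain ⟨x', y', θ, h'⟩ := h'
  -- A section `i` of `y` transports `θ` to `V`. Pushing back along `y` recovers `θ`, so the
  -- quotient of `Q` by `Z` is `T`.
  obtain ⟨i, hi⟩ := hS.exists_lift h (𝟙 L) (hLZ _)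
  obtain ⟨Q, g, g', hQ⟩ := exists_realizes (S.push i θ)
  obtain ⟨N, _, _, _, _, _, _, h1, h2, _⟩ := hS.et4 h hQ
  rw [← push_comp, hi, push_id] at h2
  obtain ⟨e⟩ := h2.iso h'
  exact ⟨Q, hQ.triangle, hS.triangle_of_iso_ends h1.triangle (Iso.refl _) e⟩

/-- If `V` is the split extension of `W` by `L`, a deflation `W' ⟶ L` with kernel `L'` gives a
deflation to `V` from an extension of `W` by `W'`, with the same kernel. -/
lemma exists_deflation_of_split {L V W W' L' : B} (h : S.Triangle L V W) (hWL : S.Orth W L)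
    (h' : S.Triangle L' W' L) : ∃ Q, S.Triangle L' Q V ∧ S.Triangle W' Q W := by
  obtain ⟨x, y, κ, h⟩ := h
  obtain ⟨x', y', θ, h'⟩ := h'
  obtain ⟨r, hr⟩ := hS.exists_extension h (𝟙 L) (hWL _)
  obtain ⟨Q, g', g, hQ⟩ := exists_realizes (S.pull r θ)
  obtain ⟨N, _, _, _, _, _, _, h1, h2, _⟩ := hS.et4_op h hQ
  rw [← pull_comp, hr, pull_id] at h2
  obtain ⟨e⟩ := h2.iso h'
  exact ⟨Q, hQ.triangle, hS.triangle_of_iso_ends h1.triangle e (Iso.refl _)⟩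

/-! ### Vanishing of `𝔼` along triangles -/

lemma orth_mid_right {A M C X : B} (h : S.Triangle A M C) (hA : S.Orth X A) (hC : S.Orth X C) :
    S.Orth X M := fun ε => by
  obtain ⟨x, y, δ, h⟩ := h
  obtain ⟨N, p, q, h'⟩ := exists_realizes ε
  obtain ⟨E, _, d, e, δ'', -, -, -, h2, -, h4⟩ := hS.et4 h h'
  obtain ⟨s, hs⟩ := hS.exists_lift h2 (𝟙 X) (by rw [hC (S.push y ε), pull_zero])
  -- The section `s` shows that `ε` is pushed forward along `x` from an element of `𝔼(X, A)`.
  rw [← S.pull_id ε, ← hs, pull_comp, ← h4, ← push_pull, hA (S.pull s δ''), push_zero]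

lemma orth_mid_left {A M C Y : B} (h : S.Triangle A M C) (hA : S.Orth A Y) (hC : S.Orth C Y) :
    S.Orth M Y := fun ε => by
  obtain ⟨x, y, δ, h⟩ := h
  obtain ⟨N, p, q, h'⟩ := exists_realizes ε
  obtain ⟨E, _, d, e, δ'', -, -, -, h2, -, h4⟩ := hS.et4_op h h'
  obtain ⟨r, hr⟩ := hS.exists_extension h2 (𝟙 Y) (by rw [hA (S.pull x ε), push_zero])
  rw [← S.push_id ε, ← hr, push_comp, ← h4, push_pull, hC (S.push r δ''), pull_zero]

lemma orth_sub_left {A M C Y : B} (h : S.Triangle A M C) (hCA : S.Orth C A) (hM : S.Orth M Y) :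
    S.Orth A Y := by
  obtain ⟨e⟩ := hS.iso_biprod_of_orth h hCA
  exact hM.of_retract_left (biprod.inl ≫ e.inv) (e.hom ≫ biprod.fst) (by simp)

lemma orth_quot_right {A M C X : B} (h : S.Triangle A M C) (hCA : S.Orth C A)
    (hM : S.Orth X M) : S.Orth X C := by
  obtain ⟨e⟩ := hS.iso_biprod_of_orth h hCA
  exact hM.of_retract_right (biprod.inr ≫ e.inv) (e.hom ≫ biprod.snd) (by simp)

/-- Exactness of `𝔼(X, M) ⟶ 𝔼(X, C) ⟶ 𝔼²(X, A)`, where `I` is injective. -/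
lemma orth_right_of_cosyzygy {A M C I A' X : B} (h : S.Triangle A M C) (hI : S.IsInjective I)
    (hA : S.Triangle A I A') (hM : S.Orth X M) (hA' : S.Orth X A') : S.Orth X C := by
  obtain ⟨V, h1, h2⟩ := hS.exists_pushout h hA
  exact hS.orth_quot_right h1 (hS.orth_injective hI C) (hS.orth_mid_right h2 hM hA')

/-- Exactness of `𝔼(M, Y) ⟶ 𝔼(A, Y) ⟶ 𝔼²(C, Y)`, where `P` is projective. -/
lemma orth_left_of_syzygy {A M C P C' Y : B} (h : S.Triangle A M C) (hP : S.IsProjective P)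
    (hC : S.Triangle C' P C) (hM : S.Orth M Y) (hC' : S.Orth C' Y) : S.Orth A Y := by
  obtain ⟨V, h1, h2⟩ := hS.exists_pullback h hC
  exact hS.orth_sub_left h1 (hS.orth_projective hP A) (hS.orth_mid_left h2 hC' hM)

/-- Exactness of `𝔼(A, Y) ⟶ 𝔼²(C, Y) ⟶ 𝔼²(M, Y)`, where `P` and `Q` are projective. -/
lemma orth_syzygy_left {A M C P C' Q M' Y : B} (h : S.Triangle A M C) (hP : S.IsProjective P)
    (hC : S.Triangle C' P C) (hQ : S.IsProjective Q) (hM : S.Triangle M' Q M) (hA : S.Orth A Y)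
    (hM' : S.Orth M' Y) : S.Orth C' Y := by
  obtain ⟨V, h1, h2⟩ := hS.exists_pullback h hC
  exact hS.orth_left_of_syzygy h2 hQ hM (hS.orth_mid_left h1 hA (hS.orth_projective hP Y)) hM'

/-- Dimension shifting: `𝔼(ΩX, Y)` and `𝔼(X, ΣY)` vanish simultaneously. -/
lemma orth_syzygy_iff {X' P X Y I Y' : B} (hP : S.IsProjective P) (hX : S.Triangle X' P X)
    (hI : S.IsInjective I) (hY : S.Triangle Y I Y') : S.Orth X' Y ↔ S.Orth X Y' := by
  constructor
  · intro h ε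
    obtain ⟨x, y, δ, hX⟩ := hX
    obtain ⟨x', y', θ, hY⟩ := hY
    obtain ⟨N, p, q, hN⟩ := exists_realizes ε
    -- Projectivity of `P` gives `ε = a_* δ`. Then `a` factors through `I`, hence through the
    -- inflation `X' ⟶ P`, which kills `δ`.
    obtain ⟨t, ht⟩ := hP p q ⟨ε, hN⟩ y
    obtain ⟨a, ha, haε⟩ := hS.et3_op hX hN t (𝟙 X) (by simpa using ht.symm)
    rw [pull_id] at haε
    obtain ⟨b, hb⟩ := hS.exists_lift hY a (h _)
    obtain ⟨c, hc⟩ := hI x y ⟨δ, hX⟩ b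
    rw [← haε, ← hb, ← hc, push_comp, push_comp, hS.push_inc_eq_zero hX, push_zero, push_zero]
  · intro h ε
    obtain ⟨x, y, δ, hX⟩ := hX
    obtain ⟨x', y', θ, hY⟩ := hY
    obtain ⟨N, p, q, hN⟩ := exists_realizes ε
    obtain ⟨t, ht⟩ := hI p q ⟨ε, hN⟩ x'
    obtain ⟨c, hc, hcε⟩ := hS.et3 hN hY (𝟙 Y) t (by simpa using ht)
    rw [push_id] at hcε
    obtain ⟨b, hb⟩ := hS.exists_extension hX c (h _)
    obtain ⟨d, hd⟩ := hP x' y' ⟨θ, hY⟩ b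
    rw [hcε, ← hb, ← hd, pull_comp, pull_comp, hS.pull_proj_eq_zero hY, pull_zero, pull_zero]

end IsExtriangulated

/-- `𝔼ⁿ⁺¹(X, Y) = 0`. -/
def OrthN (S : ExtData.{w} B) [S.EnoughProjectives] (n : ℕ) (X Y : B) : Prop :=
  S.Orth (S.iterSyzygy n X) Y

lemma exists_syzygy_triangle [S.EnoughProjectives] (X : B) :
    ∃ P, S.IsProjective P ∧ S.Triangle (S.syzygy X) P X :=
  (EnoughProjectives.exists_triangle (S := S) X).choose_spec

lemma iterSyzygy_succ [S.EnoughProjectives] (n : ℕ) (X : B) :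
    S.iterSyzygy (n + 1) X = S.syzygy (S.iterSyzygy n X) :=
  Function.iterate_succ_apply' _ _ _

/-! ### Higher extensions -/

namespace IsExtriangulated

variable (hS : S.IsExtriangulated) [S.EnoughProjectives]
include hS

/-- Moving a syzygy to a cosyzygy of the second argument lets inductions on the degree vary only
that argument, so the chosen syzygies of `A`, `M`, `C` need no comparison in higher degrees. -/
lemma orthN_succ_iff {n : ℕ} {X Y I Y' : B} (hI : S.IsInjective I) (hY : S.Triangle Y I Y') :
    S.OrthN (n + 1) X Y ↔ S.OrthN n X Y' := by
  obtain ⟨P, hP, hX⟩ := exists_syzygy_triangle (S := S) (S.iterSyzygy n X)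
  rw [OrthN, iterSyzygy_succ]
  exact hS.orth_syzygy_iff hP hX hI hY

lemma orthN_mid_right {n : ℕ} {A M C X : B} (h : S.Triangle A M C) (hA : S.OrthN n X A)
    (hC : S.OrthN n X C) : S.OrthN n X M :=
  hS.orth_mid_right h hA hC

variable [S.EnoughInjectives]

lemma orthN_right {n : ℕ} {A M C X : B} (h : S.Triangle A M C) (hM : S.OrthN n X M)
    (hA : S.OrthN (n + 1) X A) : S.OrthN n X C := by
  obtain ⟨I, A', hI, hA'⟩ := EnoughInjectives.exists_triangle (S := S) A
  rw [hS.orthN_succ_iff hI hA'] at hA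
  exact hS.orth_right_of_cosyzygy h hI hA' hM hA

lemma orthN_left {n : ℕ} {A M C Y : B} (h : S.Triangle A M C) (hM : S.OrthN n M Y)
    (hC : S.OrthN (n + 1) C Y) : S.OrthN n A Y := by
  induction n generalizing Y with
  | zero =>
    obtain ⟨P, hP, hC'⟩ := exists_syzygy_triangle (S := S) C
    exact hS.orth_left_of_syzygy h hP hC' hM hC
  | succ n ih =>
    obtain ⟨I, Y', hI, hY'⟩ := EnoughInjectives.exists_triangle (S := S) Y
    rw [hS.orthN_succ_iff hI hY'] at hM hC ⊢
    exact ih hM hC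

lemma orthN_succ_left {n : ℕ} {A M C Y : B} (h : S.Triangle A M C) (hA : S.OrthN n A Y)
    (hM : S.OrthN (n + 1) M Y) : S.OrthN (n + 1) C Y := by
  induction n generalizing Y with
  | zero =>
    obtain ⟨P, hP, hC'⟩ := exists_syzygy_triangle (S := S) C
    obtain ⟨Q, hQ, hM'⟩ := exists_syzygy_triangle (S := S) M
    exact hS.orth_syzygy_left h hP hC' hQ hM' hA hM
  | succ n ih =>
    obtain ⟨I, Y', hI, hY'⟩ := EnoughInjectives.exists_triangle (S := S) Y
    rw [hS.orthN_succ_iff hI hY'] at hA hM ⊢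
    exact ih hA hM

lemma orthN_of_addClosure {n : ℕ} {T X Y : B} (h : S.OrthN n T Y) (hX : addClosure T X) :
    S.OrthN n X Y := by
  induction n generalizing Y with
  | zero => exact Orth.of_addClosure h hX
  | succ n ih =>
    obtain ⟨I, Y', hI, hY'⟩ := EnoughInjectives.exists_triangle (S := S) Y
    rw [hS.orthN_succ_iff hI hY'] at h ⊢
    exact ih h

end IsExtriangulated

/-! ### Coinduction for `_ω𝒳` -/

section Perp

variable [S.EnoughProjectives] {ω 𝒳 : ObjectProperty B}

lemma rightPerp.orthN {X Y : B} (h : S.rightPerp ω Y) (hX : ω X) (n : ℕ) : S.OrthN n X Y :=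
  h X hX n

lemma rightPerp.orth {X Y : B} (h : S.rightPerp ω Y) (hX : ω X) : S.Orth X Y :=
  h X hX 0

lemma leftX.rightPerp {A : B} (h : S.leftX ω A) : S.rightPerp ω A := by
  obtain ⟨K, W, rfl, h⟩ := h
  exact (h 0).2.1

lemma leftX.exists_triangle {A : B} (h : S.leftX ω A) :
    ∃ K W, ω W ∧ S.leftX ω K ∧ S.Triangle K W A := by
  obtain ⟨K, W, rfl, h⟩ := h
  exact ⟨K 1, W 0, (h 0).1, ⟨fun n => K (n + 1), fun n => W (n + 1), rfl, fun n => h (n + 1)⟩,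
    (h 0).2.2⟩

/-- `_ω𝒳` is the largest class of objects in `ω^⊥` each of which is the cone of an inflation
from an object of the class to an object of `ω`. -/
lemma le_leftX (h : 𝒳 ≤ S.rightPerp ω)
    (h' : ∀ A, 𝒳 A → ∃ K W, ω W ∧ 𝒳 K ∧ S.Triangle K W A) : 𝒳 ≤ S.leftX ω := by
  intro A hA
  choose K W hW hK hT using h'
  let f : {A // 𝒳 A} → {A // 𝒳 A} := fun A => ⟨K A.1 A.2, hK A.1 A.2⟩
  refine ⟨fun n => (f^[n] ⟨A, hA⟩).1, fun n => W _ (f^[n] ⟨A, hA⟩).2, rfl, fun n =>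
    ⟨hW _ _, h _ (f^[n] ⟨A, hA⟩).2, ?_⟩⟩
  simp only [Function.iterate_succ_apply']
  exact hT _ _

lemma leftX_of_triangle {K W A : B} (hA : S.rightPerp ω A) (hK : S.leftX ω K) (hW : ω W)
    (h : S.Triangle K W A) : S.leftX ω A := by
  refine le_leftX (𝒳 := fun A => S.rightPerp ω A ∧ ∃ K W, ω W ∧ S.leftX ω K ∧ S.Triangle K W A)
    (fun A hA => hA.1) ?_ A ⟨hA, K, W, hW, hK, h⟩
  rintro A ⟨-, K, W, hW, hK, h⟩
  exact ⟨K, W, hW, ⟨hK.rightPerp, hK.exists_triangle⟩, h⟩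

lemma check_mono (h : ω ≤ 𝒳) : S.check ω ≤ S.check 𝒳 := by
  rintro A ⟨n, hA⟩
  refine ⟨n, ?_⟩
  induction n generalizing A with
  | zero => exact h _ hA
  | succ n ih =>
    obtain ⟨W, K, hW, hK, hT⟩ := hA
    exact ⟨W, K, h _ hW, ih _ hK, hT⟩

lemma le_check : ω ≤ S.check ω := fun _ hA => ⟨0, hA⟩

lemma check_of_triangle {A W K : B} (h : S.Triangle A W K) (hW : ω W) (hK : S.check ω K) :
    S.check ω A := by
  obtain ⟨n, hK⟩ := hK
  exact ⟨n + 1, W, K, hW, hK, h⟩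

end Perp

lemma _root_.Extri.IsSubcategory.exists_isZero {ω : ObjectProperty B} (hω : IsSubcategory ω) :
    ∃ Z, IsZero Z ∧ ω Z := by
  exact ⟨_, isZero_zero B, hω.zero (isZero_zero B)⟩

/-! ### Closure properties of `_ω𝒳` and `check ω` -/

namespace IsExtriangulated

variable (hS : S.IsExtriangulated) {ω 𝒳 : ObjectProperty B}
include hS

lemma mem_of_triangle (hω : IsSubcategory ω) {A M C : B} (h : S.Triangle A M C)
    (hCA : S.Orth C A) (hA : ω A) (hC : ω C) : ω M := by
  obtain ⟨e⟩ := hS.iso_biprod_of_orth h hCA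
  exact hω.iso e.symm (hω.sum hA hC)

variable [S.EnoughProjectives]

lemma rightPerp_mid {A M C : B} (h : S.Triangle A M C) (hA : S.rightPerp ω A)
    (hC : S.rightPerp ω C) : S.rightPerp ω M :=
  fun _ hX n => hS.orthN_mid_right h (hA.orthN hX n) (hC.orthN hX n)

/-- `_ω𝒳` is closed under extensions. -/
lemma leftX_mid (hω : IsSubcategory ω) (hω' : S.SelfOrthogonal ω) {L N K : B}
    (h : S.Triangle L N K) (hL : S.leftX ω L) (hK : S.leftX ω K) : S.leftX ω N := by
  refine le_leftX (𝒳 := fun N => ∃ L K, S.Triangle L N K ∧ S.leftX ω L ∧ S.leftX ω K)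
    ?_ ?_ N ⟨L, K, h, hL, hK⟩
  · rintro N ⟨L, K, h, hL, hK⟩
    exact hS.rightPerp_mid h hL.rightPerp hK.rightPerp
  · rintro N ⟨L, K, h, hL, hK⟩
    obtain ⟨L', V, hV, hL', h1⟩ := hL.exists_triangle
    obtain ⟨K', W, hW, hK', h2⟩ := hK.exists_triangle
    -- Horseshoe argument: over `W` the extension by `L` splits, so `V ⟶ L` extends to a deflation
    -- onto `U`, and the composite `Q ⟶ U ⟶ N` starts the resolution.
    obtain ⟨U, hU, hU'⟩ := hS.exists_pullback h h2
    obtain ⟨Q, hQ, hQ'⟩ := hS.exists_deflation_of_split hU (hL.rightPerp.orth hW) h1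
    obtain ⟨N', hN', hN''⟩ := hS.exists_triangles_of_deflations hU' hQ
    exact ⟨N', Q, hS.mem_of_triangle hω hQ' ((hω' _ hV).orth hW) hV hW,
      ⟨L', K', hN'', hL', hK'⟩, hN'⟩

variable [S.EnoughInjectives]

lemma rightPerp_cone {A M C : B} (h : S.Triangle A M C) (hA : S.rightPerp ω A)
    (hM : S.rightPerp ω M) : S.rightPerp ω C :=
  fun _ hX n => hS.orthN_right h (hM.orthN hX n) (hA.orthN hX (n + 1))

lemma hat_le_rightPerp (hω' : S.SelfOrthogonal ω) : S.hat ω ≤ S.rightPerp ω := by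
  rintro A ⟨n, hA⟩
  induction n generalizing A with
  | zero => exact hω' _ hA
  | succ n ih =>
    obtain ⟨K, W, hW, hK, hT⟩ := hA
    exact hS.rightPerp_cone hT (ih _ hK) (hω' _ hW)

lemma hat_le_leftX (hω : IsSubcategory ω) (hω' : S.SelfOrthogonal ω) :
    S.hat ω ≤ S.leftX ω := by
  refine le_leftX (hS.hat_le_rightPerp hω') ?_
  rintro A ⟨n, hA⟩
  cases n with
  | zero =>
    obtain ⟨Z, hZ, hZω⟩ := hω.exists_isZero
    exact ⟨Z, A, hA, ⟨0, hZω⟩, hS.triangle_zero_left hZ A⟩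
  | succ n =>
    obtain ⟨K, W, hW, hK, hT⟩ := hA
    exact ⟨K, W, hW, ⟨n, hK⟩, hT⟩

lemma le_leftX_self (hω : IsSubcategory ω) (hω' : S.SelfOrthogonal ω) : ω ≤ S.leftX ω :=
  fun A hA => hS.hat_le_leftX hω hω' A ⟨0, hA⟩

/-- `_ω𝒳` is closed under cones of inflations. -/
lemma leftX_cone (hω : IsSubcategory ω) (hω' : S.SelfOrthogonal ω) {A M C : B}
    (h : S.Triangle A M C) (hA : S.leftX ω A) (hM : S.leftX ω M) : S.leftX ω C := by
  obtain ⟨K, W, hW, hK, h1⟩ := hM.exists_triangle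
  obtain ⟨N, hN, hN'⟩ := hS.exists_triangles_of_deflations h h1
  exact leftX_of_triangle (hS.rightPerp_cone h hA.rightPerp hM.rightPerp)
    (hS.leftX_mid hω hω' hN' hK hA) hW hN

/-- The pullback `V` of `M ⟶ C` and `W ⟶ C` is an extension of `M` by `K`, hence in `_ω𝒳`. It splits
as `A ⊞ W`, so `A` is the cone of `W ⟶ V`. -/
lemma leftX_of_rightPerp (hω : IsSubcategory ω) (hω' : S.SelfOrthogonal ω) {A M C : B}
    (h : S.Triangle A M C) (hA : S.rightPerp ω A) (hM : S.leftX ω M) (hC : S.leftX ω C) :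
    S.leftX ω A := by
  obtain ⟨K, W, hW, hK, h1⟩ := hC.exists_triangle
  obtain ⟨V, hV, hV'⟩ := hS.exists_pullback h h1
  obtain ⟨e⟩ := hS.iso_biprod_of_orth hV (hA.orth hW)
  exact hS.leftX_cone hω hω' ((hS.realizes_inr W A).triangle.of_iso e.symm)
    (hS.le_leftX_self hω hω' _ hW) (hS.leftX_mid hω hω' hV' hK hM)

lemma check_leftX_inf_rightPerp_le (hω : IsSubcategory ω) (hω' : S.SelfOrthogonal ω) :
    S.check (S.leftX ω) ⊓ S.rightPerp ω ≤ S.leftX ω := by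
  rintro A ⟨⟨n, hA⟩, hA'⟩
  induction n generalizing A with
  | zero => exact hA
  | succ n ih =>
    obtain ⟨W, K, hW, hK, hT⟩ := hA
    exact hS.leftX_of_rightPerp hω hω' hT hA' hW
      (ih _ (hS.rightPerp_cone hT hA' hW.rightPerp) hK)

lemma orthN_of_check {X Y : B} (hX : S.check ω X) (hY : S.rightPerp ω Y) (n : ℕ) :
    S.OrthN n X Y := by
  obtain ⟨m, hX⟩ := hX
  induction m generalizing X n with
  | zero => exact hY.orthN hX n
  | succ m ih =>
    obtain ⟨W, K, hW, hK, hT⟩ := hX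
    exact hS.orthN_left hT (hY.orthN hW n) (ih (n + 1) hK)

/-- The first triangle `A ⟶ W ⟶ K` of a coresolution splits, making `A` a summand of `W`. -/
lemma check_inf_rightPerp_le (hω : IsSubcategory ω) : S.check ω ⊓ S.rightPerp ω ≤ ω := by
  rintro A ⟨⟨n, hA⟩, hA'⟩
  cases n with
  | zero => exact hA
  | succ n =>
    obtain ⟨W, K, hW, hK, hT⟩ := hA
    obtain ⟨e⟩ := hS.iso_biprod_of_orth hT (hS.orthN_of_check ⟨n, hK⟩ hA' 0)
    exact hω.summand (hω.iso e hW)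

/-- An extension of an object of `check ω` by an object of `check 𝒳` lies in `check 𝒳`. -/
lemma check_mid (h𝒳 : 𝒳 ≤ S.rightPerp ω)
    (hmid : ∀ {A M C}, S.Triangle A M C → 𝒳 A → ω C → 𝒳 M) (hzero : ∃ Z, IsZero Z ∧ 𝒳 Z)
    {A M C : B} (h : S.Triangle A M C) (hA : S.check 𝒳 A) (hC : S.check ω C) :
    S.check 𝒳 M := by
  have key : ∀ {A}, S.check 𝒳 A → ∃ W K, 𝒳 W ∧ S.check 𝒳 K ∧ S.Triangle A W K := by
    rintro A ⟨n, hA⟩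
    cases n with
    | zero =>
      obtain ⟨Z, hZ, hZ'⟩ := hzero
      exact ⟨A, Z, hA, ⟨0, hZ'⟩, hS.triangle_zero_right hZ A⟩
    | succ n =>
      obtain ⟨W, K, hW, hK, hT⟩ := hA
      exact ⟨W, K, hW, ⟨n, hK⟩, hT⟩
  obtain ⟨m, hC⟩ := hC
  induction m generalizing A M C with
  | zero =>
    obtain ⟨W, K, hW, hK, hT⟩ := key hA
    obtain ⟨V, hV, hV'⟩ := hS.exists_pushout h hT
    exact check_of_triangle hV' (hmid hV hW hC) hK
  | succ m ih =>
    obtain ⟨W, K, hW, hK, hT⟩ := key hA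
    obtain ⟨V, hV, hV'⟩ := hS.exists_pushout h hT
    -- This splits `W ⟶ V ⟶ C`, so `C ⟶ U` extends to an inflation `V ⟶ Q`; the cone of `M ⟶ Q` is
    -- an extension of `L` by `K`, with `L` one step shorter than `C`.
    have hCW : S.Orth C W := hS.orthN_of_check ⟨m + 1, hC⟩ (h𝒳 _ hW) 0
    obtain ⟨U, L, hU, hL, hCU⟩ := hC
    obtain ⟨Q, hQ, hQ'⟩ := hS.exists_inflation_of_split hV hCW hCU
    obtain ⟨N, hN, hN'⟩ := hS.exists_triangles_of_inflations hV' hQ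
    exact check_of_triangle hN (hmid hQ' hW hU) (ih hN' hK hL)

end IsExtriangulated

/-! ### Tilting pairs -/

namespace IsTiltingPair

variable [S.EnoughProjectives] [S.EnoughInjectives] {𝒞 𝒯 : ObjectProperty B}

lemma rightPerp_le (h : S.IsTiltingPair 𝒞 𝒯) (hS : S.IsExtriangulated) :
    S.rightPerp 𝒯 ≤ S.rightPerp 𝒞 :=
  fun _ hY _ hX n => hS.orthN_of_check (h.left_le _ hX) hY n

lemma leftX_le (h : S.IsTiltingPair 𝒞 𝒯) (hS : S.IsExtriangulated) (h𝒞 : IsSubcategory 𝒞) :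
    S.leftX 𝒯 ≤ S.leftX 𝒞 := by
  have hle := hS.hat_le_leftX h𝒞 h.left_selfOrthogonal
  -- Replacing `U` in `𝒯` by a cover `W` in `𝒞` leaves a kernel that is an extension of `K'` by
  -- `U'`. The class must therefore allow a part `L` in `_𝒞𝒳`.
  have : (fun N => ∃ L K, S.Triangle L N K ∧ S.leftX 𝒞 L ∧ S.leftX 𝒯 K) ≤ S.leftX 𝒞 := by
    refine le_leftX ?_ ?_
    · rintro N ⟨L, K, hT, hL, hK⟩
      exact hS.rightPerp_mid hT hL.rightPerp (h.rightPerp_le hS _ hK.rightPerp)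
    · rintro N ⟨L, K, hT, hL, hK⟩
      obtain ⟨L', V, hV, hL', h1⟩ := hL.exists_triangle
      obtain ⟨K', U, hU, hK', h2⟩ := hK.exists_triangle
      obtain ⟨U', W, hW, hU', h3⟩ := (hle _ (h.right_le _ hU)).exists_triangle
      obtain ⟨M, hM, hM'⟩ := hS.exists_triangles_of_deflations h2 h3
      obtain ⟨X, hX, hX'⟩ := hS.exists_pullback hT hM
      obtain ⟨Q, hQ, hQ'⟩ := hS.exists_deflation_of_split hX (hL.rightPerp.orth hW) h1
      obtain ⟨N', hN', hN''⟩ := hS.exists_triangles_of_deflations hX' hQ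
      obtain ⟨R, hR, hR'⟩ := hS.exists_triangles_of_deflations hM' hN''
      exact ⟨N', Q, hS.mem_of_triangle h𝒞 hQ' ((h.left_selfOrthogonal _ hV).orth hW) hV hW,
        ⟨R, K', hR, hS.leftX_mid h𝒞 h.left_selfOrthogonal hR' hL' hU', hK'⟩, hN'⟩
  intro A hA
  obtain ⟨Z, hZ, hZ𝒞⟩ := h𝒞.exists_isZero
  exact this _ ⟨Z, A, hS.triangle_zero_left hZ A, hle _ ⟨0, hZ𝒞⟩, hA⟩

lemma exists_orthN (h : S.IsTiltingPair 𝒞 𝒯) (hS : S.IsExtriangulated) (hfin : IsFinite 𝒯) :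
    ∃ n, ∀ X Y, 𝒯 X → S.rightPerp 𝒞 Y → ∀ i, n ≤ i → S.OrthN i X Y := by
  obtain ⟨T, rfl⟩ := hfin
  have hT : addClosure T T :=
    ⟨1, _, ⟨(isoBiprodZero (isZero_zero B)).symm ≪≫
      (biproductUniqueIso fun _ : Fin 1 => T).symm⟩⟩
  obtain ⟨n, hn⟩ := h.right_le _ hT
  have key : ∀ n X Y, S.hatN 𝒞 n X → S.rightPerp 𝒞 Y → ∀ i, n ≤ i → S.OrthN i X Y := by
    intro n
    induction n with
    | zero => exact fun X Y hX hY i _ => hY.orthN hX i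
    | succ n ih =>
      rintro X Y ⟨K, W, hW, hK, hX⟩ hY (_ | i) hi
      · omega
      · exact hS.orthN_succ_left hX (ih K Y hK hY i (by omega)) (hY.orthN hW _)
  exact ⟨n, fun X Y hX hY i hi => hS.orthN_of_addClosure (key n T Y hn hY i hi) hX⟩

lemma check_right_mid (h : S.IsTiltingPair 𝒞 𝒯) (hS : S.IsExtriangulated)
    (h𝒯 : IsSubcategory 𝒯) {A M C : B} (hT : S.Triangle A M C) (hA : S.check 𝒯 A)
    (hC : S.check 𝒯 C) : S.check 𝒯 M :=
  hS.check_mid h.right_selfOrthogonal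
    (fun hT hA hC => hS.mem_of_triangle h𝒯 hT ((h.right_selfOrthogonal _ hA).orth hC) hA hC)
    h𝒯.exists_isZero hT hA hC

/-- `_𝒞𝒳` has coapproximations by objects without extensions of high degree by `𝒯`. -/
lemma exists_triangle_orthN (h : S.IsTiltingPair 𝒞 𝒯) (hS : S.IsExtriangulated)
    (h𝒞 : IsSubcategory 𝒞) (h𝒯 : IsSubcategory 𝒯) {n : ℕ}
    (hn : ∀ X Y, 𝒯 X → S.rightPerp 𝒞 Y → ∀ i, n ≤ i → S.OrthN i X Y) (j k : ℕ) (hjk : j + k = n)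
    {Y : B} (hY : S.leftX 𝒞 Y) :
    ∃ U L, S.Triangle Y U L ∧ S.leftX 𝒞 U ∧ (∀ X, 𝒯 X → ∀ i, j ≤ i → S.OrthN i X U) ∧
      S.check 𝒯 L ∧ S.leftX 𝒞 L := by
  have hle := hS.hat_le_leftX h𝒞 h.left_selfOrthogonal
  have h𝒞X := hS.le_leftX_self h𝒞 h.left_selfOrthogonal
  induction k generalizing j Y with
  | zero =>
    obtain ⟨Z, hZ, hZ𝒞⟩ := h𝒞.exists_isZero
    exact ⟨Y, Z, hS.triangle_zero_right hZ Y, hY,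
      fun X hX i hi => hn X Y hX hY.rightPerp i (by omega), ⟨0, h𝒯.zero hZ⟩, h𝒞X _ hZ𝒞⟩
  | succ k ih =>
    obtain ⟨K, W, hW, hK, h1⟩ := hY.exists_triangle
    -- The syzygy `K` is treated with the weaker bound `j + 1`. Below, `N` is the cone of `U ⟶ T`
    -- with `T` in `𝒯`, so its extensions from `𝒯` vanish one degree earlier.
    obtain ⟨U, L, h2, hU, hU', hL, hL'⟩ := ih (j + 1) (by omega) hK
    obtain ⟨V, hV, hV'⟩ := hS.exists_pushout h1 h2
    have hVX : S.leftX 𝒞 V := hS.leftX_mid h𝒞 h.left_selfOrthogonal hV' (h𝒞X _ hW) hL'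
    have hVT : S.check 𝒯 V := h.check_right_mid hS h𝒯 hV' (h.left_le _ hW) hL
    obtain ⟨T, M, hT, hM, h3⟩ : ∃ T M, 𝒯 T ∧ S.check 𝒯 M ∧ S.Triangle V T M := by
      obtain ⟨m, hVT⟩ := hVT
      cases m with
      | zero =>
        obtain ⟨Z, hZ, hZ𝒯⟩ := h𝒯.exists_isZero
        exact ⟨V, Z, hVT, ⟨0, hZ𝒯⟩, hS.triangle_zero_right hZ V⟩
      | succ m =>
        obtain ⟨T, M, hT, hM, h3⟩ := hVT
        exact ⟨T, M, hT, ⟨m, hM⟩, h3⟩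
    have hMX : S.leftX 𝒞 M :=
      hS.leftX_cone h𝒞 h.left_selfOrthogonal h3 hVX (hle _ (h.right_le _ hT))
    obtain ⟨N, hN, hN'⟩ := hS.exists_triangles_of_inflations hV h3
    exact ⟨N, M, hN', hS.leftX_mid h𝒞 h.left_selfOrthogonal hN' hY hMX, fun X hX i hi =>
      hS.orthN_right hN ((h.right_selfOrthogonal _ hT).orthN hX i) (hU' X hX (i + 1) (by omega)),
      hM, hMX⟩

lemma exists_triangle_rightPerp (h : S.IsTiltingPair 𝒞 𝒯) (hS : S.IsExtriangulated)
    (h𝒞 : IsSubcategory 𝒞) (h𝒯 : IsSubcategory 𝒯) (hfin : IsFinite 𝒯) {Y : B}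
    (hY : S.leftX 𝒞 Y) :
    ∃ U L, S.Triangle Y U L ∧ (S.leftX 𝒞 ⊓ S.rightPerp 𝒯) U ∧ S.check 𝒯 L := by
  obtain ⟨n, hn⟩ := h.exists_orthN hS hfin
  obtain ⟨U, L, h1, hU, hU', hL, -⟩ :=
    h.exists_triangle_orthN hS h𝒞 h𝒯 hn 0 n (by omega) hY
  exact ⟨U, L, h1, ⟨hU, fun X hX i => hU' X hX i (by omega)⟩, hL⟩

/-- Pushing `K ⟶ W ⟶ A` out along `K ⟶ U` puts the middle term in `check 𝒯 ∩ 𝒯^⊥`, hence in `𝒯`,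
while `U` stays in the class. -/
lemma leftX_inf_rightPerp_le (h : S.IsTiltingPair 𝒞 𝒯) (hS : S.IsExtriangulated)
    (h𝒞 : IsSubcategory 𝒞) (h𝒯 : IsSubcategory 𝒯) (hfin : IsFinite 𝒯) :
    S.leftX 𝒞 ⊓ S.rightPerp 𝒯 ≤ S.leftX 𝒯 := by
  refine le_leftX inf_le_right ?_
  rintro A ⟨hA, hA'⟩
  obtain ⟨K, W, hW, hK, h1⟩ := hA.exists_triangle
  obtain ⟨U, L, h2, hU, hL⟩ := h.exists_triangle_rightPerp hS h𝒞 h𝒯 hfin hK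
  obtain ⟨V, hV, hV'⟩ := hS.exists_pushout h1 h2
  exact ⟨U, V, hS.check_inf_rightPerp_le h𝒯 _
    ⟨h.check_right_mid hS h𝒯 hV' (h.left_le _ hW) hL, hS.rightPerp_mid hV hU.2 hA'⟩, hU, hV⟩

lemma exists_triangle_check (h : S.IsTiltingPair 𝒞 𝒯) (hS : S.IsExtriangulated)
    (h𝒞 : IsSubcategory 𝒞) (h𝒯 : IsSubcategory 𝒯) (hfin : IsFinite 𝒯) {Y : B}
    (hY : S.leftX 𝒞 Y) : ∃ U L, S.Triangle Y U L ∧ S.leftX 𝒯 U ∧ S.check 𝒯 L := by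
  obtain ⟨U, L, h1, hU, hL⟩ := h.exists_triangle_rightPerp hS h𝒞 h𝒯 hfin hY
  exact ⟨U, L, h1, h.leftX_inf_rightPerp_le hS h𝒞 h𝒯 hfin _ hU, hL⟩

lemma check_leftX_le (h : S.IsTiltingPair 𝒞 𝒯) (hS : S.IsExtriangulated)
    (h𝒞 : IsSubcategory 𝒞) (h𝒯 : IsSubcategory 𝒯) (hfin : IsFinite 𝒯) :
    S.check (S.leftX 𝒞) ≤ S.check (S.leftX 𝒯) := by
  have hself := hS.le_leftX_self h𝒯 h.right_selfOrthogonal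
  rintro A ⟨n, hA⟩
  induction n generalizing A with
  | zero =>
    obtain ⟨U, L, h1, hU, hL⟩ := h.exists_triangle_check hS h𝒞 h𝒯 hfin hA
    exact check_of_triangle h1 hU (check_mono hself _ hL)
  | succ n ih =>
    obtain ⟨W, K, hW, hK, hT⟩ := hA
    obtain ⟨U, L, h1, hU, hL⟩ := h.exists_triangle_check hS h𝒞 h𝒯 hfin hW
    -- The cone `N` of `A ⟶ W ⟶ U` is an extension of `L` in `check 𝒯` by `K`, which the induction
    -- already covers.
    obtain ⟨N, hN, hN'⟩ := hS.exists_triangles_of_inflations hT h1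
    obtain ⟨Z, hZ, hZ𝒯⟩ := h𝒯.exists_isZero
    exact check_of_triangle hN hU (hS.check_mid (fun _ hX => leftX.rightPerp hX)
      (fun hT hA hC => hS.leftX_mid h𝒯 h.right_selfOrthogonal hT hA (hself _ hC))
      ⟨Z, hZ, hself _ hZ𝒯⟩ hN' (ih _ hK) hL)

end IsTiltingPair

end ExtData

end Extri

theorem mainTheorem8 {B : Type u} [Category.{v} B] [Preadditive B] [HasFiniteBiproducts B]
    (hKS : Extri.IsKrullSchmidt B)
    (S : Extri.ExtData.{w} B) (hS : S.IsExtriangulated)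
    [S.EnoughProjectives] [S.EnoughInjectives] (hWIC : S.WIC)
    (𝒞 𝒯 : ObjectProperty B)
    (h𝒞 : Extri.IsSubcategory 𝒞) (h𝒯 : Extri.IsSubcategory 𝒯)
    (hTilt : S.IsTiltingPair 𝒞 𝒯) (hFin : Extri.IsFinite 𝒯) :
    S.leftX 𝒞 = S.check (S.leftX 𝒯) ⊓ S.rightPerp 𝒞 ∧
      S.check (S.leftX 𝒯) = S.check (S.leftX 𝒞) := by
  have h : S.check (S.leftX 𝒯) = S.check (S.leftX 𝒞) :=
    le_antisymm (Extri.ExtData.check_mono (hTilt.leftX_le hS h𝒞))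
      (hTilt.check_leftX_le hS h𝒞 h𝒯 hFin)
  refine ⟨le_antisymm (fun A hA => ?_) ?_, h⟩
  · rw [h]
    exact ⟨Extri.ExtData.le_check _ hA, hA.rightPerp⟩
  · rw [h]
    exact hS.check_leftX_inf_rightPerp_le h𝒞 hTilt.left_selfOrthogonal
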